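/- A *ceer* is a computably enumerable equivalence relation on $\omega$; it is *infinite* if it has infinitely many equivalence classes. For ceers $R,S$ write $R\leq_{\mathrm c} S$ if there is a computable $f:\omega\to\omega$ with $x\,R\,y\Leftrightarrow f(x)\,S\,f(y)$ for all $x,y$; the *$\mathrm c$-degrees* are the equivalence classes of ceers under $R\equiv_{\mathrm c}S :\Leftrightarrow R\leq_{\mathrm c}S\leq_{\mathrm c}R$, partially ordered by $\leq_{\mathrm c}$. Let $R\oplus S=\{(2x,2y): x\,R\,y\}\cup\{(2x+1,2y+1): x\,S\,y\}$, let $\mathrm{Id}_\omega$ be equality on $\omega$, and for $n\geq 1$ let $\mathrm{Id}_n$ be a fixed ceer with exactly $n$ classes (say congruence modulo $n$). A ceer $R$ is *dark* if it is infinite and $\mathrm{Id}_\omega\not\leq_{\mathrm c}R$. Write $R\leq_{\mathcal I}S$ if $R\leq_{\mathrm c}S\oplus\mathrm{Id}_n$ for some $n\geq1$, and let $\mathbf{dark}_{/\mathcal I}$ be the set of equivalence classes of dark ceers under mutual $\leq_{\mathcal I}$-reducibility, partially ordered by $\leq_{\mathcal I}$. A *c.e. presentation* of a semigroup $A$ consists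 of a computable binary operation on $\omega$ and a ceer $=_A$ that is a congruence for it, such that the quotient is isomorphic to $A$; the ceer $=_A$ is called the word problem of $A$ (for this presentation). Let $\mathbf S_{f.g.}^\infty$ be the set of $\mathrm c$-degrees that contain an infinite ceer and contain the word problem of a c.e. presentation of some finitely generated semigroup, partially ordered by $\leq_{\mathrm c}$. **Corollary 3.5.** The map $R\mapsto R\oplus\mathrm{Id}_\omega$ induces an embedding of partial orders $\mathbf{dark}_{/\mathcal I}\hookrightarrow\mathbf S_{f.g.}^\infty$. That is, for every dark ceer $R$ the $\mathrm c$-degree of $R\oplus\mathrm{Id}_\omega$ lies in $\mathbf S_{f.g.}^\infty$, and for all dark ceers $R,S$ one has $R\leq_{\mathcal I}S$ if and only if $R\oplus\mathrm{Id}_\omega\leq_{\mathrm c}S\oplus\mathrm{Id}_\omega$. -/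

import Mathlib

namespace CeerDegrees

/-- A computably enumerable equivalence relation (ceer) on the natural numbers. -/
structure Ceer where
  /-- the underlying equivalence relation -/
  rel : Setoid ℕ
  /-- the set of equivalent pairs is computably enumerable -/
  ce : REPred fun p : ℕ × ℕ => rel p.1 p.2

/-- Computable reducibility of equivalence relations on the natural numbers. -/
def CReducible (R S : Setoid ℕ) : Prop :=
  ∃ f : ℕ → ℕ, Computable f ∧ ∀ x y, R x y ↔ S (f x) (f y)

/-- Ceers are preordered by computable reducibility. -/
instance : Preorder Ceer where
  le R S := CReducible R.rel S.rel
  le_refl R := ⟨id, Computable.id, fun _ _ => Iff.rfl⟩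
  le_trans R S T := by
    rintro ⟨f, hf, hf'⟩ ⟨g, hg, hg'⟩
    exact ⟨fun x => g (f x), hg.comp hf, fun x y => (hf' x y).trans (hg' _ _)⟩

/-- The partial order of `c`-degrees of ceers. -/
abbrev CDegree : Type := Antisymmetrization Ceer (· ≤ ·)

/-- The `c`-degree of a ceer. -/
def cdeg (R : Ceer) : CDegree := toAntisymmetrization (· ≤ ·) R

/-- A ceer is infinite if it has infinitely many equivalence classes. -/
def Ceer.IsInfinite (R : Ceer) : Prop := Infinite (Quotient R.rel)

theorem rePred_of_computable {p : ℕ × ℕ → Prop} [DecidablePred p]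
    (h : Computable fun a => decide (p a)) : REPred p :=
  (ComputablePred.computable_iff.2 ⟨_, h, by ext; simp⟩).to_re

/-- The ceer `Id_ω`: equality on the natural numbers. -/
def idOmega : Ceer where
  rel := ⊥
  ce := rePred_of_computable (p := fun p : ℕ × ℕ => p.1 = p.2)
    (Primrec.eq.decide.comp .fst .snd).to_comp

/-- The ceer `Id_n`, here congruence modulo `n`; for `n ≥ 1` it has exactly `n` classes. (It is
only used for `n ≥ 1`.) -/
def idMod (n : ℕ) : Ceer where
  rel := ⟨fun x y => x ≡ y [MOD n],
    ⟨fun _ => rfl, fun h => h.symm, fun h h' => h.trans h'⟩⟩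
  ce := rePred_of_computable (p := fun p : ℕ × ℕ => p.1 % n = p.2 % n)
    (Primrec.eq.decide.comp (Primrec.nat_mod.comp .fst (.const n))
      (Primrec.nat_mod.comp .snd (.const n))).to_comp

/-- The relation `U ⊕ V = {(2x, 2y) : x U y} ∪ {(2x+1, 2y+1) : x V y}`. -/
def JoinRel (U V : Setoid ℕ) (m n : ℕ) : Prop :=
  (∃ x y, U x y ∧ m = 2 * x ∧ n = 2 * y) ∨
    (∃ x y, V x y ∧ m = 2 * x + 1 ∧ n = 2 * y + 1)

theorem joinRel_iff (U V : Setoid ℕ) (m n : ℕ) :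
    JoinRel U V m n ↔ m % 2 = n % 2 ∧
      ((m % 2 = 0 ∧ U (m / 2) (n / 2)) ∨ (m % 2 = 1 ∧ V (m / 2) (n / 2))) := by
  constructor
  · rintro (⟨x, y, h, rfl, rfl⟩ | ⟨x, y, h, rfl, rfl⟩)
    · refine ⟨by omega, Or.inl ⟨by omega, ?_⟩⟩
      simpa using h
    · refine ⟨by omega, Or.inr ⟨by omega, ?_⟩⟩
      rwa [show (2 * x + 1) / 2 = x by omega, show (2 * y + 1) / 2 = y by omega]
  · rintro ⟨h, ⟨h0, hU⟩ | ⟨h1, hV⟩⟩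
    · exact Or.inl ⟨_, _, hU, by omega, by omega⟩
    · exact Or.inr ⟨_, _, hV, by omega, by omega⟩

/-- The uniform join of two equivalence relations on the natural numbers. -/
def joinSetoid (U V : Setoid ℕ) : Setoid ℕ where
  r := JoinRel U V
  iseqv := by
    refine ⟨fun x => ?_, fun {x y} h => ?_, fun {x y z} h h' => ?_⟩
    · rw [joinRel_iff]
      exact ⟨rfl, (Nat.mod_two_eq_zero_or_one x).imp
        (fun h => ⟨h, U.refl _⟩) (fun h => ⟨h, V.refl _⟩)⟩
    · rw [joinRel_iff] at h ⊢
      obtain ⟨h, ⟨h0, hU⟩ | ⟨h1, hV⟩⟩ := h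
      · exact ⟨h.symm, Or.inl ⟨by omega, U.symm hU⟩⟩
      · exact ⟨h.symm, Or.inr ⟨by omega, V.symm hV⟩⟩
    · rw [joinRel_iff] at h h' ⊢
      obtain ⟨h, ⟨h0, hU⟩ | ⟨h1, hV⟩⟩ := h <;> obtain ⟨h', ⟨h0', hU'⟩ | ⟨h1', hV'⟩⟩ := h'
      · exact ⟨by omega, Or.inl ⟨by omega, U.trans hU hU'⟩⟩
      · omega
      · omega
      · exact ⟨by omega, Or.inr ⟨by omega, V.trans hV hV'⟩⟩

/-- The uniform join `U ⊕ V` of two ceers. -/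
def Ceer.join (U V : Ceer) : Ceer where
  rel := joinSetoid U.rel V.rel
  ce := by
    have half : Computable fun p : ℕ × ℕ => (p.1 / 2, p.2 / 2) :=
      ((Primrec.nat_div.comp .fst (.const 2)).pair
        (Primrec.nat_div.comp .snd (.const 2))).to_comp
    have even : Computable fun p : ℕ × ℕ => decide (p.1 % 2 = 0) :=
      (Primrec.eq.decide.comp (Primrec.nat_mod.comp .fst (.const 2)) (.const 0)).to_comp
    have same : Computable fun p : ℕ × ℕ => decide (p.1 % 2 = p.2 % 2) :=
      (Primrec.eq.decide.comp (Primrec.nat_mod.comp .fst (.const 2))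
        (Primrec.nat_mod.comp .snd (.const 2))).to_comp
    have key := Partrec.cond same
      (Partrec.cond even (Partrec.comp U.ce half) (Partrec.comp V.ce half)) Partrec.none
    refine REPred.of_eq key.dom_re fun p => ?_
    refine Iff.trans ?_ (joinRel_iff U.rel V.rel p.1 p.2).symm
    by_cases h : p.1 % 2 = p.2 % 2
    · rcases Nat.mod_two_eq_zero_or_one p.1 with h0 | h1
      · simp [h0, ← h, Part.assert]
      · simp [h1, ← h, Part.assert]
    · simp [h]

/-- A ceer is dark if it is infinite and `Id_ω` is not `c`-reducible to it. -/
def Ceer.IsDark (R : Ceer) : Prop := R.IsInfinite ∧ ¬ idOmega ≤ R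

/-- `R` is `I`-reducible to `S` if `R` is `c`-reducible to `S ⊕ Id_n` for some `n ≥ 1`. -/
def IReducible (R S : Ceer) : Prop := ∃ n : ℕ, 1 ≤ n ∧ R ≤ S.join (idMod n)

theorem IReducible.refl (R : Ceer) : IReducible R R := by
  refine ⟨1, le_rfl, fun x => 2 * x, (Primrec.nat_mul.comp (.const 2) .id).to_comp, fun x y => ?_⟩
  refine Iff.trans ?_ (joinRel_iff _ _ _ _).symm
  simp

theorem IReducible.trans {R S T : Ceer} (h : IReducible R S) (h' : IReducible S T) :
    IReducible R T := by
  obtain ⟨n, hn, f, hf, hfR⟩ := h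
  obtain ⟨m, hm, g, hg, hgS⟩ := h'
  have hmod (k : ℕ) : Computable fun x : ℕ => x % k := (Primrec.nat_mod.comp .id (.const k)).to_comp
  have hdiv : Computable fun x : ℕ => x / 2 := (Primrec.nat_div.comp .id (.const 2)).to_comp
  have hodd : Computable fun x : ℕ => 2 * x + 1 :=
    (Primrec.nat_add.comp (Primrec.nat_mul.comp (.const 2) .id) (.const 1)).to_comp
  have hadd : Computable fun x : ℕ => m + x := (Primrec.nat_add.comp (.const m) .id).to_comp
  have hp : ComputablePred fun x : ℕ => x % 2 = 0 :=
    Computable.computablePred (Primrec.eq.decide.comp (Primrec.nat_mod.comp .id (.const 2))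
      (.const 0)).to_comp
  have hq : Computable fun z : ℕ => if z % 2 = 0 then z else 2 * (z / 2 % m) + 1 :=
    hp.ite .id (hodd.comp ((hmod m).comp hdiv))
  have hr : Computable fun y : ℕ => if y % 2 = 0 then
      (fun z => if z % 2 = 0 then z else 2 * (z / 2 % m) + 1) (g (y / 2))
      else 2 * (m + y / 2 % n) + 1 :=
    hp.ite (hq.comp (hg.comp hdiv)) (hodd.comp (hadd.comp ((hmod n).comp hdiv)))
  refine ⟨m + n, by omega, _, hr.comp hf, fun x y => ?_⟩
  rw [hfR]
  change JoinRel S.rel (idMod n).rel _ _ ↔ JoinRel T.rel (idMod (m + n)).rel _ _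
  have hgS' : ∀ a b, S.rel a b ↔ JoinRel T.rel (idMod m).rel (g a) (g b) := hgS
  have idm (k a b : ℕ) : (idMod k).rel a b ↔ a % k = b % k := Iff.rfl
  rw [joinRel_iff, joinRel_iff, hgS', joinRel_iff]
  simp only [idm]
  have small (a : ℕ) : a / 2 % m % (m + n) = a / 2 % m :=
    Nat.mod_eq_of_lt (by have := Nat.mod_lt (a / 2) hm; omega)
  have large (a : ℕ) : (m + a / 2 % n) % (m + n) = m + a / 2 % n :=
    Nat.mod_eq_of_lt (by have := Nat.mod_lt (a / 2) hn; omega)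
  have lt (a : ℕ) : a / 2 % m < m := Nat.mod_lt _ hm
  have half (a : ℕ) : (2 * a + 1) / 2 = a := by omega
  have one (a : ℕ) : (2 * a + 1) % 2 = 1 := by omega
  have ne (a b : ℕ) : a / 2 % m ≠ m + b / 2 % n := by have := lt a; omega
  rcases Nat.mod_two_eq_zero_or_one (f x) with hx | hx <;>
    rcases Nat.mod_two_eq_zero_or_one (f y) with hy | hy <;>
    rcases Nat.mod_two_eq_zero_or_one (g (f x / 2)) with hgx | hgx <;>
    rcases Nat.mod_two_eq_zero_or_one (g (f y / 2)) with hgy | hgy <;>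
    simp [hx, hy, hgx, hgy, half, one, small, large, ne, (ne _ _).symm]

/-- A dark ceer. -/
structure DarkCeer where
  /-- the underlying ceer -/
  toCeer : Ceer
  dark : toCeer.IsDark

/-- Dark ceers are preordered by `I`-reducibility. -/
instance : Preorder DarkCeer where
  le R S := IReducible R.toCeer S.toCeer
  le_refl R := IReducible.refl _
  le_trans _ _ _ := IReducible.trans

/-- The partial order of `I`-degrees of dark ceers. -/
abbrev DarkIDegree : Type := Antisymmetrization DarkCeer (· ≤ ·)

/-- The `I`-degree of a dark ceer. -/
def ideg (R : DarkCeer) : DarkIDegree := toAntisymmetrization (· ≤ ·) R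

/-- A c.e. presentation of a structure `A` with one binary operation: a computable binary operation
on the natural numbers, together with a ceer that is a congruence for this operation and such that
the quotient is isomorphic to `A`. -/
structure CEPresentation (A : Type) [Mul A] where
  /-- the operation on the natural numbers (unrelated to the usual multiplication) -/
  mul : Mul ℕ
  computable_mul : Computable₂ mul.mul
  /-- the congruence on the natural numbers -/
  con : @Con ℕ mul
  ce : REPred fun p : ℕ × ℕ => (@Con.toSetoid ℕ mul con) p.1 p.2
  /-- the isomorphism between the quotient and `A` -/
  iso : @MulEquiv (@Con.Quotient ℕ mul con) A (@Con.hasMul ℕ mul con) _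

/-- The word problem of (a c.e. presentation of) `A`. -/
def CEPresentation.wordProblem {A : Type} [Mul A] (P : CEPresentation A) : Ceer where
  rel := @Con.toSetoid ℕ P.mul P.con
  ce := P.ce

/-- A ceer is `c`-realized by a semigroup `A` if it has the same `c`-degree as the word problem of
`A`, for some c.e. presentation of `A`. -/
def CRealized (R : Ceer) (A : Type) [Semigroup A] : Prop :=
  ∃ P : CEPresentation A, cdeg R = cdeg P.wordProblem

/-- A semigroup is finitely generated if some finite subset generates it. -/
def FinitelyGenerated (A : Type) [Semigroup A] : Prop :=
  ∃ X : Finset A, Subsemigroup.closure (X : Set A) = ⊤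

/-- The `c`-degrees of ceers that are `c`-realized by finitely generated semigroups. -/
def Sfg : Set CDegree :=
  {d | ∃ R : Ceer, cdeg R = d ∧
    ∃ (A : Type) (_ : Semigroup A), FinitelyGenerated A ∧ CRealized R A}

/-- The `c`-degrees of infinite ceers. -/
def InfDegrees : Set CDegree := {d | ∃ R : Ceer, cdeg R = d ∧ R.IsInfinite}

/-- The `c`-degrees of infinite ceers that are `c`-realized by finitely generated semigroups,
ordered as a subset of the `c`-degrees. -/
abbrev SfgInf : Type := {d : CDegree // d ∈ Sfg ∩ InfDegrees}

end CeerDegrees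

namespace CeerDegrees

/-! Order: `Id_n` sits inside `Id_ω` with room left for another copy of `Id_ω`, so an `I`-reduction
extends to the joins. Conversely, a reduction of a dark `R` to `S ⊕ Id_ω` meets only finitely many
classes of `Id_ω`; infinitely many could be searched out effectively, giving `Id_ω ≤ R`. Hence
`Id_n` suffices for some `n` (`iReducible_of_le_join_idOmega`).

Realization works for every ceer `R`: let `b` occur only at the start and `c` only at the end of a
nonzero word. Then the words `b * a ^ n * c` annihilate everything on both sides, so they can be
identified according to `R` without any further collapse (`wordMul_congr`). They carry `R`, the
other words carry `Id_ω`, and finitely many generators suffice. -/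

theorem CReducible.rePred {R S : Setoid ℕ} (h : CReducible R S)
    (hS : REPred fun p : ℕ × ℕ => S p.1 p.2) : REPred fun p : ℕ × ℕ => R p.1 p.2 := by
  obtain ⟨f, hf, hfR⟩ := h
  have hff : Computable fun p : ℕ × ℕ => (f p.1, f p.2) :=
    (hf.comp .fst).pair (hf.comp .snd)
  have h : REPred fun p : ℕ × ℕ => S (f p.1) (f p.2) := Partrec.comp hS hff
  exact h.of_eq fun p => (hfR p.1 p.2).symm

/-! ### Comparing joins with `Id_ω` -/

theorem IReducible.join_idOmega_le {R S : Ceer} (h : IReducible R S) :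
    R.join idOmega ≤ S.join idOmega := by
  obtain ⟨n, hn, f, hf, hfR⟩ := h
  have hdiv : Computable fun x : ℕ => x / 2 := (Primrec.nat_div.comp .id (.const 2)).to_comp
  have hp : ComputablePred fun x : ℕ => x % 2 = 0 :=
    Computable.computablePred (Primrec.eq.decide.comp (Primrec.nat_mod.comp .id (.const 2))
      (.const 0)).to_comp
  -- Residues represent the classes of `Id_n`, turning congruence into equality; the original `Id_ω`
  -- summand is then shifted by `n` to avoid them.
  have hq : Computable fun z : ℕ => if z % 2 = 0 then z else 2 * (z / 2 % n) + 1 :=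
    hp.ite .id (Primrec.nat_add.comp (Primrec.nat_mul.comp (.const 2) (Primrec.nat_mod.comp
      (Primrec.nat_div.comp .id (.const 2)) (.const n))) (.const 1)).to_comp
  have hodd : Computable fun z : ℕ => 2 * (n + z / 2) + 1 :=
    (Primrec.nat_add.comp (Primrec.nat_mul.comp (.const 2) (Primrec.nat_add.comp (.const n)
      (Primrec.nat_div.comp .id (.const 2)))) (.const 1)).to_comp
  refine ⟨_, hp.ite (hq.comp (hf.comp hdiv)) hodd, fun x y => ?_⟩
  change JoinRel R.rel ⊥ x y ↔ JoinRel S.rel ⊥ _ _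
  have hfR' : ∀ a b, R.rel a b ↔ JoinRel S.rel (idMod n).rel (f a) (f b) := hfR
  have idm (a b : ℕ) : (idMod n).rel a b ↔ a % n = b % n := Iff.rfl
  have bot (a b : ℕ) : (⊥ : Setoid ℕ) a b ↔ a = b := Iff.rfl
  rw [joinRel_iff, joinRel_iff, hfR', joinRel_iff]
  simp only [idm, bot]
  have half (a : ℕ) : (2 * a + 1) / 2 = a := by omega
  have one (a : ℕ) : (2 * a + 1) % 2 = 1 := by omega
  have ne (a b : ℕ) : a / 2 % n ≠ n + b / 2 := by
    have := Nat.mod_lt (a / 2) hn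
    omega
  rcases Nat.mod_two_eq_zero_or_one x with hx | hx <;>
    rcases Nat.mod_two_eq_zero_or_one y with hy | hy <;>
    rcases Nat.mod_two_eq_zero_or_one (f (x / 2)) with hfx | hfx <;>
    rcases Nat.mod_two_eq_zero_or_one (f (y / 2)) with hfy | hfy <;>
    simp [hx, hy, hfx, hfy, half, one, ne, (ne _ _).symm]

/-- A computable search whose goal always exists is given by a computable function. -/
theorem exists_computable_choice {q : ℕ → ℕ → Bool} (hq : Computable₂ q)
    (h : ∀ n, ∃ x, q n x = true) : ∃ f : ℕ → ℕ, Computable f ∧ ∀ n, q n (f n) = true := by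
  have hfind : Partrec fun n : ℕ => Nat.rfind fun x => Part.some (q n x) :=
    Partrec.rfind hq.partrec₂
  have hdom (n : ℕ) : (Nat.rfind fun x => Part.some (q n x)).Dom := by
    obtain ⟨x, hx⟩ := h n
    exact Nat.rfind_dom.2 ⟨x, by simp [hx], fun _ => trivial⟩
  refine ⟨fun n => (Nat.rfind _).get (hdom n),
    hfind.of_eq fun n => (Part.some_get (hdom n)).symm, fun n => ?_⟩
  have hn := Nat.rfind_spec (Part.get_mem (hdom n))
  rw [Part.mem_some_iff] at hn
  exact hn.symm

theorem exists_computable_iterate {f : ℕ → ℕ} (hf : Computable f) (a : ℕ) :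
    ∃ s : ℕ → ℕ, Computable s ∧ s 0 = a ∧ ∀ k, s (k + 1) = f (s k) :=
  ⟨fun k => Nat.rec a (fun _ y => f y) k,
    Computable.nat_rec .id (.const a) (hf.comp (Computable.snd.comp .snd)).to₂, rfl, fun _ => rfl⟩

theorem computable_decide_lt {f g : ℕ × ℕ → ℕ} (hf : Computable f) (hg : Computable g) :
    Computable fun a => decide (f a < g a) :=
  Computable₂.comp (f := fun a b : ℕ => decide (a < b)) Primrec.nat_lt.decide.to_comp hf hg

theorem computable_and {p q : ℕ × ℕ → Bool} (hp : Computable p) (hq : Computable q) :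
    Computable fun a => p a && q a :=
  Primrec.and.to_comp.comp hp hq

/-- If infinitely many values of a computable function satisfy a decidable property, then some
computable sequence of arguments has strictly increasing values with this property. -/
theorem exists_computable_strictMono_comp {g : ℕ → ℕ} (hg : Computable g) {p : ℕ → Prop}
    (hp : ComputablePred p) (h : ∀ n, ∃ x, p (g x) ∧ n < g x) :
    ∃ s : ℕ → ℕ, Computable s ∧ (∀ k, p (g (s k))) ∧ StrictMono fun k => g (s k) := by
  obtain ⟨q, hq, rfl⟩ := ComputablePred.computable_iff.1 hp
  have hqg : Computable fun a : ℕ × ℕ => q (g a.2) := hq.comp (hg.comp .snd)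
  have htest := computable_and hqg (computable_decide_lt .fst (hg.comp .snd))
  obtain ⟨next, hnext, spec⟩ := exists_computable_choice
    (q := fun n x => q (g x) && decide (n < g x)) htest.to₂ (by simpa using h)
  simp only [Bool.and_eq_true, decide_eq_true_eq] at spec
  -- The value just reached serves as the lower bound for the next search.
  obtain ⟨s, hs, hs0, hs1⟩ := exists_computable_iterate (hnext.comp hg) (next 0)
  refine ⟨s, hs, fun k => ?_, strictMono_nat_of_lt_succ fun k => ?_⟩
  · cases k with
    | zero => rw [hs0]; exact (spec 0).1
    | succ k => rw [hs1]; exact (spec (g (s k))).1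
  · rw [hs1]
    exact (spec (g (s k))).2

/-- Darkness bounds the odd values of the reduction: an increasing computable sequence of them would
pull back to pairwise inequivalent elements of `R`. -/
theorem iReducible_of_le_join_idOmega {R S : Ceer} (hR : R.IsDark) (h : R ≤ S.join idOmega) :
    IReducible R S := by
  obtain ⟨g, hg, hgR⟩ := h
  have hgR' : ∀ a b, R.rel a b ↔ JoinRel S.rel ⊥ (g a) (g b) := hgR
  have bot (a b : ℕ) : (⊥ : Setoid ℕ) a b ↔ a = b := Iff.rfl
  simp only [joinRel_iff, bot] at hgR'
  have hp : ComputablePred fun x : ℕ => x % 2 = 1 :=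
    Computable.computablePred (Primrec.eq.decide.comp (Primrec.nat_mod.comp .id (.const 2))
      (.const 1)).to_comp
  obtain ⟨n, hn⟩ : ∃ n, ∀ x, g x % 2 = 1 → g x ≤ n := by
    by_contra! hunb
    obtain ⟨s, hs, hsodd, hmono⟩ := exists_computable_strictMono_comp hg hp hunb
    refine hR.2 ⟨s, hs, fun x y => ?_⟩
    rw [hgR']
    change x = y ↔ _
    constructor
    · rintro rfl
      simp [hsodd]
    · intro hxy
      have hx := hsodd x
      have hy := hsodd y
      exact hmono.injective (show g (s x) = g (s y) by omega)
  -- The same `g` works: halves of odd values are at most `n`, so congruence modulo `n + 1` is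
  -- equality on them.
  refine ⟨n + 1, by omega, g, hg, fun x y => ?_⟩
  rw [hgR']
  change _ ↔ JoinRel S.rel (idMod (n + 1)).rel _ _
  have idm (a b : ℕ) : (idMod (n + 1)).rel a b ↔ a % (n + 1) = b % (n + 1) := Iff.rfl
  rw [joinRel_iff]
  simp only [idm]
  refine and_congr_right fun hxy => or_congr_right (and_congr_right fun hx => ?_)
  have h1 := hn x hx
  have h2 := hn y (by omega)
  rw [Nat.mod_eq_of_lt (by omega), Nat.mod_eq_of_lt (by omega)]

theorem Ceer.le_join_left (R S : Ceer) : R ≤ R.join S := by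
  refine ⟨fun x => 2 * x, (Primrec.nat_mul.comp (.const 2) .id).to_comp, fun x y => ?_⟩
  refine Iff.trans ?_ (joinRel_iff _ _ _ _).symm
  simp

theorem Ceer.IsDark.iReducible_iff {R S : Ceer} (hR : R.IsDark) :
    IReducible R S ↔ R.join idOmega ≤ S.join idOmega :=
  ⟨IReducible.join_idOmega_le, fun h =>
    iReducible_of_le_join_idOmega hR ((R.le_join_left idOmega).trans h)⟩

theorem isInfinite_join_idOmega (R : Ceer) : (R.join idOmega).IsInfinite := by
  refine Infinite.of_injective (fun x : ℕ => (Quotient.mk (R.join idOmega).rel (2 * x + 1)))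
    fun x y hxy => ?_
  have h : JoinRel R.rel ⊥ (2 * x + 1) (2 * y + 1) := Quotient.exact hxy
  rw [joinRel_iff] at h
  obtain ⟨-, ⟨h0, -⟩ | ⟨-, h⟩⟩ := h
  · omega
  · have h' : (2 * x + 1) / 2 = (2 * y + 1) / 2 := h
    omega

/-! ### A finitely generated semigroup realizing `R ⊕ Id_ω`

The elements are the words `b ^ i * a ^ n * c ^ j` with `i, j ≤ 1` and a zero. A product is zero
as soon as a `c` stands to the left of another factor or a `b` to the right of one. The word with
exponents `i, n, j` is coded by `4 * n + 2 * i + j + 1`, and zero by `0`. -/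

/-- The product of codes of words. -/
def wordMul (x y : ℕ) : ℕ :=
  if x ≠ 0 ∧ y ≠ 0 ∧ (x - 1) % 2 = 0 ∧ (y - 1) / 2 % 2 = 0 then
    4 * ((x - 1) / 4 + (y - 1) / 4) + 2 * ((x - 1) / 2 % 2) + (y - 1) % 2 + 1
  else 0

theorem wordMul_assoc (x y z : ℕ) : wordMul (wordMul x y) z = wordMul x (wordMul y z) := by
  unfold wordMul
  grind

theorem computable₂_wordMul : Computable₂ wordMul := by
  have hx : Primrec fun p : ℕ × ℕ => p.1 - 1 := Primrec.nat_sub.comp .fst (.const 1)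
  have hy : Primrec fun p : ℕ × ℕ => p.2 - 1 := Primrec.nat_sub.comp .snd (.const 1)
  have half {f : ℕ × ℕ → ℕ} (hf : Primrec f) (k : ℕ) : Primrec fun p => f p / k :=
    Primrec.nat_div.comp hf (.const k)
  have par {f : ℕ × ℕ → ℕ} (hf : Primrec f) (k : ℕ) : Primrec fun p => f p % k :=
    Primrec.nat_mod.comp hf (.const k)
  have eq0 {f : ℕ × ℕ → ℕ} (hf : Primrec f) : PrimrecPred fun p => f p = 0 :=
    Primrec.eq.comp hf (.const 0)
  have h : Primrec fun p : ℕ × ℕ => wordMul p.1 p.2 :=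
    Primrec.ite ((eq0 .fst).not.and ((eq0 .snd).not.and ((eq0 (par hx 2)).and
        (eq0 (par (half hy 2) 2)))))
      (Primrec.nat_add.comp (Primrec.nat_add.comp (Primrec.nat_add.comp
        (Primrec.nat_mul.comp (.const 4) (Primrec.nat_add.comp (half hx 4) (half hy 4)))
        (Primrec.nat_mul.comp (.const 2) (par (half hx 2) 2))) (par hy 2)) (.const 1))
      (.const 0)
  exact h.to_comp

/-- Equality of words, where `b * a ^ n * c` and `b * a ^ m * c` are identified if `n` and `m` are
equivalent. -/
def wordSetoid (R : Setoid ℕ) : Setoid ℕ where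
  r x y := x = y ∨ (x ≠ 0 ∧ x % 4 = 0) ∧ (y ≠ 0 ∧ y % 4 = 0) ∧ R (x / 4 - 1) (y / 4 - 1)
  iseqv := by
    refine ⟨fun x => Or.inl rfl, fun {x y} h => ?_, fun {x y z} h h' => ?_⟩
    · obtain rfl | ⟨hx, hy, h⟩ := h
      · exact Or.inl rfl
      · exact Or.inr ⟨hy, hx, R.symm h⟩
    · obtain rfl | ⟨hx, hy, h⟩ := h
      · exact h'
      · obtain rfl | ⟨_, hz, h'⟩ := h'
        · exact Or.inr ⟨hx, hy, h⟩
        · exact Or.inr ⟨hx, hz, R.trans h h'⟩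

theorem wordSetoid_iff (R : Setoid ℕ) (x y : ℕ) : wordSetoid R x y ↔
    x = y ∨ (x ≠ 0 ∧ x % 4 = 0) ∧ (y ≠ 0 ∧ y % 4 = 0) ∧ R (x / 4 - 1) (y / 4 - 1) := Iff.rfl

/-- Identified words have nonzero codes divisible by 4; each both starts with `b` and ends with `c`,
so all products with it vanish. -/
theorem wordMul_congr {R : Setoid ℕ} {w x y z : ℕ} (h : wordSetoid R w x)
    (h' : wordSetoid R y z) : wordSetoid R (wordMul w y) (wordMul x z) := by
  have left {u v : ℕ} (hu : u % 4 = 0) : wordMul u v = 0 := if_neg (by omega)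
  have right {u v : ℕ} (hv : v % 4 = 0) : wordMul u v = 0 := if_neg (by omega)
  rw [wordSetoid_iff] at h h'
  obtain rfl | ⟨hw, hx, -⟩ := h
  · obtain rfl | ⟨hy, hz, -⟩ := h'
    · exact Or.inl rfl
    · rw [right hy.2, right hz.2]
  · rw [left hw.2, left hx.2]

theorem wordSetoid_cReducible_join (R : Setoid ℕ) :
    CReducible (wordSetoid R) (joinSetoid R ⊥) := by
  have hp : PrimrecPred fun x : ℕ => x ≠ 0 ∧ x % 4 = 0 :=
    (Primrec.eq.comp .id (.const 0)).not.and
      (Primrec.eq.comp (Primrec.nat_mod.comp .id (.const 4)) (.const 0))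
  have hf : Primrec fun x : ℕ => if x ≠ 0 ∧ x % 4 = 0 then 2 * (x / 4 - 1) else 2 * x + 1 :=
    Primrec.ite hp
      (Primrec.nat_mul.comp (.const 2) (Primrec.nat_sub.comp
        (Primrec.nat_div.comp .id (.const 4)) (.const 1)))
      (Primrec.nat_add.comp (Primrec.nat_mul.comp (.const 2) .id) (.const 1))
  obtain ⟨f, hf, hfD, hfN⟩ : ∃ f : ℕ → ℕ, Primrec f ∧
      (∀ x, x ≠ 0 ∧ x % 4 = 0 → f x = 2 * (x / 4 - 1)) ∧
      ∀ x, ¬(x ≠ 0 ∧ x % 4 = 0) → f x = 2 * x + 1 :=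
    ⟨_, hf, fun x hx => if_pos hx, fun x hx => if_neg hx⟩
  refine ⟨f, hf.to_comp, fun x y => ?_⟩
  change _ ↔ JoinRel R ⊥ _ _
  have bot (a b : ℕ) : (⊥ : Setoid ℕ) a b ↔ a = b := Iff.rfl
  rw [joinRel_iff, wordSetoid_iff, bot]
  have half (a : ℕ) : (2 * a + 1) / 2 = a := by omega
  have one (a : ℕ) : (2 * a + 1) % 2 = 1 := by omega
  by_cases hx : x ≠ 0 ∧ x % 4 = 0 <;> by_cases hy : y ≠ 0 ∧ y % 4 = 0
  · have hR : x = y → R (x / 4 - 1) (y / 4 - 1) := by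
      rintro rfl
      exact R.refl _
    rw [hfD x hx, hfD y hy]
    simpa [hx, hy] using hR
  · rw [hfD x hx, hfN y hy]
    refine iff_of_false ?_ (by omega)
    rintro (rfl | h)
    exacts [hy hx, hy h.2.1]
  · rw [hfN x hx, hfD y hy]
    refine iff_of_false ?_ (by omega)
    rintro (rfl | h)
    exacts [hx hy, hx h.1]
  · rw [hfN x hx, hfN y hy, one, one, half, half]
    simp [hx]

theorem join_cReducible_wordSetoid (R : Setoid ℕ) :
    CReducible (joinSetoid R ⊥) (wordSetoid R) := by
  -- The codes of `b * a ^ n * c` and of `a ^ n`, where `n = x / 2`.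
  have hf : Primrec fun x : ℕ => if x % 2 = 0 then 4 * (x / 2) + 4 else 4 * (x / 2) + 1 := by
    have h : Primrec fun x : ℕ => 4 * (x / 2) :=
      Primrec.nat_mul.comp (.const 4) (Primrec.nat_div.comp .id (.const 2))
    exact Primrec.ite (Primrec.eq.comp (Primrec.nat_mod.comp .id (.const 2)) (.const 0))
      (Primrec.nat_add.comp h (.const 4)) (Primrec.nat_add.comp h (.const 1))
  refine ⟨_, hf.to_comp, fun x y => ?_⟩
  change JoinRel R ⊥ _ _ ↔ _
  have bot (a b : ℕ) : (⊥ : Setoid ℕ) a b ↔ a = b := Iff.rfl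
  rw [joinRel_iff, wordSetoid_iff]
  simp only [bot]
  have quot (a : ℕ) : (4 * a + 4) / 4 - 1 = a := by omega
  rcases Nat.mod_two_eq_zero_or_one x with hx | hx <;>
    rcases Nat.mod_two_eq_zero_or_one y with hy | hy
  · simp only [hx, hy, if_true, quot]
    refine ⟨fun h => Or.inr ⟨by omega, by omega, by simpa using h⟩, ?_⟩
    rintro (h | ⟨-, -, h⟩)
    · have h' : x / 2 = y / 2 := by omega
      simp [h']
    · simpa using h
  all_goals
    simp only [hx, hy, if_true, one_ne_zero, if_false]
    clear quot bot
    grind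

/-- The semigroup of words modulo the identifications given by `R`. -/
abbrev WordSemigroup (R : Setoid ℕ) : Type := Quotient (wordSetoid R)

instance (R : Setoid ℕ) : Semigroup (WordSemigroup R) where
  mul := Quotient.map₂ wordMul fun _ _ h _ _ h' => wordMul_congr h h'
  mul_assoc := by
    rintro ⟨x⟩ ⟨y⟩ ⟨z⟩
    exact congrArg (Quotient.mk (wordSetoid R)) (wordMul_assoc x y z)

theorem finitelyGenerated_wordSemigroup (R : Setoid ℕ) :
    FinitelyGenerated (WordSemigroup R) := by
  classical
  let w : ℕ → WordSemigroup R := Quotient.mk (wordSetoid R)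
  -- The empty word, `c`, `b` and `a`. The empty word is not an identity (times `b` it gives zero)
  -- and is not a product of other words, so it is needed as a generator.
  let X : Finset (WordSemigroup R) := {w 1, w 2, w 3, w 5}
  refine ⟨X, eq_top_iff.2 ?_⟩
  set C := Subsemigroup.closure (X : Set (WordSemigroup R))
  have hX : ∀ u ∈ X, u ∈ C := fun u hu => Subsemigroup.subset_closure hu
  have h1 : w 1 ∈ C := hX _ (by simp [X])
  have h2 : w 2 ∈ C := hX _ (by simp [X])
  have h3 : w 3 ∈ C := hX _ (by simp [X])
  have h5 : w 5 ∈ C := hX _ (by simp [X])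
  have mul {x y z : ℕ} (hx : w x ∈ C) (hy : w y ∈ C) (hz : z = wordMul x y) : w z ∈ C :=
    hz ▸ C.mul_mem hx hy
  have ha (n : ℕ) : w (4 * n + 1) ∈ C := by
    induction n with
    | zero => exact h1
    | succ n ih => exact mul h5 ih (by unfold wordMul; split_ifs <;> omega)
  have hac (n : ℕ) : w (4 * n + 2) ∈ C :=
    mul (ha n) h2 (by unfold wordMul; split_ifs <;> omega)
  rintro ⟨x⟩ -
  change w x ∈ C
  obtain rfl | ⟨n, rfl | rfl | rfl | rfl⟩ : x = 0 ∨
      ∃ n, x = 4 * n + 1 ∨ x = 4 * n + 2 ∨ x = 4 * n + 3 ∨ x = 4 * n + 4 := by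
    rcases Nat.eq_zero_or_pos x with h | h
    · exact Or.inl h
    · exact Or.inr ⟨(x - 1) / 4, by omega⟩
  -- Zero arises as `c * c`.
  · exact mul h2 h2 (by simp [wordMul])
  · exact ha n
  · exact hac n
  · exact mul h3 (ha n) (by unfold wordMul; split_ifs <;> omega)
  · exact mul h3 (hac n) (by unfold wordMul; split_ifs <;> omega)

/-- The defining presentation of the semigroup of words. -/
def wordPresentation (R : Ceer) : CEPresentation (WordSemigroup R.rel) :=
  letI : Mul ℕ := ⟨wordMul⟩
  { mul := ⟨wordMul⟩
    computable_mul := computable₂_wordMul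
    con := { wordSetoid R.rel with mul' := wordMul_congr }
    ce := (wordSetoid_cReducible_join R.rel).rePred (R.join idOmega).ce
    iso :=
      { toEquiv := Equiv.refl _
        map_mul' := by
          rintro ⟨x⟩ ⟨y⟩
          rfl } }

theorem cdeg_join_idOmega_mem_Sfg (R : Ceer) : cdeg (R.join idOmega) ∈ Sfg :=
  ⟨R.join idOmega, rfl, WordSemigroup R.rel, inferInstance, finitelyGenerated_wordSemigroup R.rel,
    wordPresentation R, Quotient.sound
      ⟨join_cReducible_wordSetoid R.rel, wordSetoid_cReducible_join R.rel⟩⟩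

end CeerDegrees

theorem corollary3p5 :
    ∃ Φ : CeerDegrees.DarkIDegree ↪o CeerDegrees.SfgInf,
      ∀ R : CeerDegrees.DarkCeer,
        (Φ (CeerDegrees.ideg R) : CeerDegrees.CDegree) =
          CeerDegrees.cdeg (R.toCeer.join CeerDegrees.idOmega) := by
  open CeerDegrees in
  let F : DarkIDegree → SfgInf := Quotient.lift
    (fun R : DarkCeer => (⟨cdeg (R.toCeer.join idOmega), cdeg_join_idOmega_mem_Sfg R.toCeer,
      _, rfl, isInfinite_join_idOmega R.toCeer⟩ : SfgInf))
    fun R S h => Subtype.ext (Quotient.sound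
      ⟨R.dark.iReducible_iff.1 h.1, S.dark.iReducible_iff.1 h.2⟩)
  refine ⟨OrderEmbedding.ofMapLEIff F ?_, fun R => rfl⟩
  rintro ⟨R⟩ ⟨S⟩
  exact R.dark.iReducible_iff.symm
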